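/- **Setting.** For $f:\mathbb{R}^d\to\mathbb{R}$ write $D_f(x,y)=f(x)-f(y)-\langle\nabla f(y),x-y\rangle$. Let $f$ be a *Bregman function* with zone $S$: $S\subset\mathbb{R}^d$ is non-empty and convex; $f$ is continuous and strictly convex on $\overline S$ and continuously differentiable on $S$; for all $\alpha\in\mathbb{R}$, $x\in\overline S$, $y\in S$ the sets $\{u\in\overline S: D_f(u,y)\le\alpha\}$ and $\{v\in S: D_f(x,v)\le\alpha\}$ are bounded; if $y_n\in S$ and $y_n\to y^*$ then $D_f(y^*,y_n)\to0$; and if $y_n\in S$, $x_n\in\overline S$, $D_f(x_n,y_n)\to0$, $y_n\to y^*$ and $(x_n)$ is bounded, then $x_n\to y^*$. The domain of $f$ is taken to be $\overline S$. Let $H_i=\{x:\langle a_i,x\rangle\le b_i\}$, $a_i\neq0$, be finitely many half-spaces, and let $C=\bigcap_iH_i=\{x: Ax\le b\}$ with $C\cap\overline S\ne\emptyset$. Suppose that each hyperplane $\partial H_i=\{x:\langle a_i,x\rangle=b_i\}$ is *strongly zone consistent*: for all $y\in S$ and all hyperplanes $K$ parallel to $\partial H_i$ and lying between $y$ and $\partial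 H_i$, the Bregman projection of $y$ onto $K$ (the minimizer of $D_f(\cdot,y)$ over $K\cap\overline S$, when it exists) lies in $S$. Suppose that $\nabla f(x_0)=0$ for some $x_0\in S$. *Oracles.* A *deterministic oracle* is a map $Q$ from points to sets of constraints for which there is a continuous non-decreasing $\phi:[0,\infty)\to[0,\infty)$, with $\phi(0)=0$ and $\phi>0$ on $(0,\infty)$, such that for every $x\notin C$ some $H_i\in Q(x)$ has $\operatorname{dist}(x,H_i)\ge\phi(\operatorname{dist}(x,C))$. A *random oracle* returns on input $x$ a random set of constraints, with a law $Q(x)$ for which there is $\tau>0$ such that, for every $x$ and every $i$, $H_i$ is returned with probability at least $\tau$; in a run, the conditional law of the answer to a query $x^\nu$, given the past of the run, is $Q(x^\nu)$. *Algorithm (Project and Forget).* Start with $x^0\in S$ such that $\nabla f(x^0)=0$, $z^0=0\in\mathbb{R}^{\{i\}}$, $L^0=\emptyset$. In iteration $\nu=0,1,\dots$ query the oracle at $x^\nu$, and let $\tilde L$ be the union of $L^\nu$ and the answer. Starting from $(x,z)=(x^\nu,z^\nu)$, process the constraints in $\tilde L$ once each, in any order (possibly depending on the past): for constraint $i$,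 find $p\in S$ and $\theta\in\mathbb{R}$ with $\nabla f(p)-\nabla f(x)=\theta a_i$ and $\langle a_i,p\rangle=b_i$, put $c=\min(z_i,\theta)$, replace $x$ by the point $x'\in S$ with $\nabla f(x')-\nabla f(x)=c\,a_i$, and replace $z_i$ by $z_i-c$. The resulting pair is $(x^{\nu+1},z^{\nu+1})$, and $L^{\nu+1}=\{i\in\tilde L: z_i^{\nu+1}\neq0\}$. **Theorem.** There is a unique minimizer $x^*$ of $f$ over $\{x\in\overline S: Ax\le b\}$, and the following hold. 1. For every run with a deterministic oracle, the points produced by the algorithm (the iterates $x^\nu$, and also the sequence of points after each single projection) converge to $x^*$. For every run with a random oracle this holds with probability $1$. 2. Suppose that $f$ is twice differentiable at $x^*$ and that the Hessian $H$ of $f$ at $x^*$ is positive definite. Then there is $\rho\in(0,1)$, the same for all oracles and runs, such that for every run with a deterministic oracle $$\limsup_{\nu\to\infty}\frac{\|x^*-x^{\nu+1}\|_H}{\|x^*-x^\nu\|_H}\le\rho,\qquad \|y\|_H^2=y^THy,$$ where $0/0$ is read as $0$; and for every run with a random oracle this holds with probability $1$. -/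

import Mathlib

open Set Filter Topology MeasureTheory
open scoped ENNReal RealInnerProductSpace

universe u v

noncomputable section

namespace ProjectForget

/-- The space `ℝ^d` with its Euclidean norm. -/
abbrev Vec (d : ℕ) := EuclideanSpace ℝ (Fin d)

variable {d : ℕ} {ι : Type*}

/-! ### Bregman functions -/

/-- The generalized Bregman distance `D_f(x, y) = f x - f y - ⟨∇f y, x - y⟩`. -/
def bregmanDist (f : Vec d → ℝ) (x y : Vec d) : ℝ :=
  f x - f y - ⟪gradient f y, x - y⟫

/-- `f` is a Bregman function with zone `S`. The effective domain of `f` is `closure S`; the values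
of the total function `f` away from `closure S` play no role in this definition, except that `f` is
differentiable (in the sense of `ℝ^d`) at the points of `S`. -/
structure IsBregmanFunction (f : Vec d → ℝ) (S : Set (Vec d)) : Prop where
  nonempty : S.Nonempty
  convex : Convex ℝ S
  continuousOn : ContinuousOn f (closure S)
  strictConvexOn : StrictConvexOn ℝ (closure S) f
  differentiableAt : ∀ x ∈ S, DifferentiableAt ℝ f x
  continuousOn_gradient : ContinuousOn (gradient f) S
  bounded_left : ∀ y ∈ S, ∀ α : ℝ,
    Bornology.IsBounded {x | x ∈ closure S ∧ bregmanDist f x y ≤ α}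
  bounded_right : ∀ x ∈ closure S, ∀ α : ℝ,
    Bornology.IsBounded {y | y ∈ S ∧ bregmanDist f x y ≤ α}
  tendsto_dist : ∀ (y : ℕ → Vec d) (y' : Vec d), (∀ n, y n ∈ S) →
    Tendsto y atTop (𝓝 y') → Tendsto (fun n => bregmanDist f y' (y n)) atTop (𝓝 0)
  tendsto_of_dist : ∀ (x y : ℕ → Vec d) (y' : Vec d), (∀ n, y n ∈ S) → (∀ n, x n ∈ closure S) →
    Tendsto (fun n => bregmanDist f (x n) (y n)) atTop (𝓝 0) →
    Tendsto y atTop (𝓝 y') → Bornology.IsBounded (range x) → Tendsto x atTop (𝓝 y')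

/-! ### Constraints -/

/-- The hyperplane `{x : ⟨a, x⟩ = β}`. -/
def hyperplane (a : Vec d) (β : ℝ) : Set (Vec d) := {x | ⟪a, x⟫ = β}

/-- The half-space `{x : ⟨a, x⟩ ≤ β}`. -/
def halfSpace (a : Vec d) (β : ℝ) : Set (Vec d) := {x | ⟪a, x⟫ ≤ β}

/-- The polyhedron `{x : A x ≤ b}`, where `a i` are the rows of `A`. -/
def feasible (a : ι → Vec d) (b : ι → ℝ) : Set (Vec d) := ⋂ i, halfSpace (a i) (b i)

/-- `p` is a Bregman projection of `y` onto `T`: it minimizes `D_f(·, y)` over `T ∩ closure S`,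
the part of `T` in the domain of `f`. -/
def IsBregmanProjection (f : Vec d → ℝ) (S T : Set (Vec d)) (y p : Vec d) : Prop :=
  p ∈ T ∩ closure S ∧ IsMinOn (fun x => bregmanDist f x y) (T ∩ closure S) p

/-- The hyperplane `{x : ⟨a, x⟩ = β}` is strongly zone consistent: the Bregman projection of any
`y ∈ S` onto any parallel hyperplane between `y` and the given one (both ends included) lies in `S`.
A hyperplane that misses the domain `closure S` has no projection and so imposes nothing. -/
def StronglyZoneConsistent (f : Vec d → ℝ) (S : Set (Vec d)) (a : Vec d) (β : ℝ) : Prop :=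
  ∀ y ∈ S, ∀ γ ∈ uIcc ⟪a, y⟫ β, ∀ p, IsBregmanProjection f S (hyperplane a γ) y p → p ∈ S

/-- `p` minimizes `f` over `{x : A x ≤ b}`, within the domain `closure S` of `f`. -/
def IsOptimal (f : Vec d → ℝ) (S : Set (Vec d)) (a : ι → Vec d) (b : ι → ℝ) (p : Vec d) : Prop :=
  p ∈ feasible a b ∩ closure S ∧ IsMinOn f (feasible a b ∩ closure S) p

/-! ### Oracles -/

/-- Deterministic separation oracle: at an infeasible `x` some returned constraint is at distance
at least `φ (dist(x, C))` from `x`. At a feasible `x` (certified by the oracle) nothing is required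
of the answer, which may be empty. -/
def IsDeterministicOracle (a : ι → Vec d) (b : ι → ℝ) (Q : Vec d → Finset ι) : Prop :=
  ∃ φ : ℝ → ℝ, φ 0 = 0 ∧ (∀ t, 0 < t → 0 < φ t) ∧ MonotoneOn φ (Ici 0) ∧ ContinuousOn φ (Ici 0) ∧
    ∀ x, x ∉ feasible a b → ∃ i ∈ Q x,
      φ (Metric.infDist x (feasible a b)) ≤ Metric.infDist x (halfSpace (a i) (b i))

/-- Random separation oracle: `Q x` is the law of the set of constraints returned on input `x`, and
every constraint is returned with probability at least `τ > 0`, whatever the input. -/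
def IsRandomOracle (Q : Vec d → PMF (Finset ι)) : Prop :=
  ∃ τ : ℝ≥0∞, 0 < τ ∧ ∀ (x : Vec d) (i : ι), τ ≤ (Q x).toOuterMeasure {A | i ∈ A}

/-! ### The algorithm -/

open Classical in
/-- One pass through the loop of `Project`, for the constraint `⟨a, ·⟩ ≤ β` with index `i`: the
primal-dual pair `(x, z)` becomes `(x', z')`. The point `p` is the Bregman projection of `x` onto the
hyperplane; `∇f` is only available on `S`, so the equations are to be solved in `S`. -/
def ProjectStep (f : Vec d → ℝ) (S : Set (Vec d)) (a : Vec d) (β : ℝ) (i : ι)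
    (x : Vec d) (z : ι → ℝ) (x' : Vec d) (z' : ι → ℝ) : Prop :=
  x' ∈ S ∧ ∃ p ∈ S, ∃ θ : ℝ,
    p ∈ hyperplane a β ∧
    gradient f p - gradient f x = θ • a ∧
    gradient f x' - gradient f x = min (z i) θ • a ∧
    z' = Function.update z i (z i - min (z i) θ)

/-- A record of everything that the algorithm computes. At the start of iteration `ν` the primal
point, the dual vector and the remembered constraints are `x ν`, `z ν`, `L ν`. In that iteration the
constraints in the list `order ν` are processed in turn; `y ν k` and `w ν k` are the primal point and
the dual vector after `k` of them (only `k ≤ (order ν).length` matters). -/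
structure Trace (d : ℕ) (ι : Type*) where
  x : ℕ → Vec d
  z : ℕ → ι → ℝ
  L : ℕ → Finset ι
  order : ℕ → List ι
  y : ℕ → ℕ → Vec d
  w : ℕ → ℕ → ι → ℝ

/-- `t` is a run of Project and Forget in which the oracle's answer in iteration `ν` is `ans ν`.
The constraints in `L ν ∪ ans ν` are processed once each, in any order, which may change from
one iteration to the next. -/
structure Trace.IsRun (f : Vec d → ℝ) (S : Set (Vec d)) (a : ι → Vec d) (b : ι → ℝ)
    (ans : ℕ → Finset ι) (t : Trace d ι) : Prop where
  x_zero_mem : t.x 0 ∈ S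
  gradient_x_zero : gradient f (t.x 0) = 0
  z_zero : t.z 0 = 0
  L_zero : t.L 0 = ∅
  order_nodup : ∀ ν, (t.order ν).Nodup
  mem_order : ∀ ν i, i ∈ t.order ν ↔ i ∈ t.L ν ∨ i ∈ ans ν
  y_zero : ∀ ν, t.y ν 0 = t.x ν
  w_zero : ∀ ν, t.w ν 0 = t.z ν
  step : ∀ ν k (hk : k < (t.order ν).length),
    ProjectStep f S (a (t.order ν)[k]) (b (t.order ν)[k]) (t.order ν)[k]
      (t.y ν k) (t.w ν k) (t.y ν (k + 1)) (t.w ν (k + 1))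
  x_succ : ∀ ν, t.x (ν + 1) = t.y ν (t.order ν).length
  z_succ : ∀ ν, t.z (ν + 1) = t.w ν (t.order ν).length
  mem_L_succ : ∀ ν i, i ∈ t.L (ν + 1) ↔ i ∈ t.order ν ∧ t.z (ν + 1) i ≠ 0

/-- A run with a deterministic oracle `Q`. -/
def IsDeterministicRun (f : Vec d → ℝ) (S : Set (Vec d)) (a : ι → Vec d) (b : ι → ℝ)
    (Q : Vec d → Finset ι) (t : Trace d ι) : Prop :=
  t.IsRun f S a b (fun ν => Q (t.x ν))

/-- A run with a random oracle `Q`, on a probability space `(Ω, P)`: `F ν` is the information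
available when the oracle is called in iteration `ν`, so that it determines `x ν` and the earlier
answers, and given this information the answer `ans ν` has law `Q (x ν)`. -/
structure IsRandomRun {Ω : Type*} [mΩ : MeasurableSpace Ω] (P : Measure Ω)
    (f : Vec d → ℝ) (S : Set (Vec d)) (a : ι → Vec d) (b : ι → ℝ) (Q : Vec d → PMF (Finset ι))
    (F : Filtration ℕ mΩ) (ans : ℕ → Ω → Finset ι) (t : Ω → Trace d ι) : Prop where
  isRun : ∀ᵐ ω ∂P, (t ω).IsRun f S a b (fun ν => ans ν ω)
  measurable_x : ∀ ν, Measurable[F ν] (fun ω => (t ω).x ν)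
  measurable_ans : ∀ ν A, MeasurableSet[F (ν + 1)] {ω | ans ν ω = A}
  law_ans : ∀ ν A,
    P[{ω | ans ν ω = A}.indicator (fun _ => (1 : ℝ)) | F ν] =ᵐ[P]
      fun ω => (Q ((t ω).x ν) A).toReal

/-- The run converges to `p`: so do the points after each projection, and in particular (`k = 0`)
the points `x ν` after each iteration. -/
def Trace.ConvergesTo (t : Trace d ι) (p : Vec d) : Prop :=
  Tendsto t.x atTop (𝓝 p) ∧
    ∀ ε > 0, ∀ᶠ ν in atTop, ∀ k ≤ (t.order ν).length, ‖t.y ν k - p‖ < ε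

/-! ### The rate -/

/-- `f` is twice differentiable at `x`: it is differentiable near `x`, and its gradient is
differentiable at `x`. -/
def TwiceDifferentiableAt (f : Vec d → ℝ) (x : Vec d) : Prop :=
  (∀ᶠ y in 𝓝 x, DifferentiableAt ℝ f y) ∧ DifferentiableAt ℝ (gradient f) x

/-- The Hessian of `f` at `x`, as a linear operator. -/
def hessian (f : Vec d → ℝ) (x : Vec d) : Vec d →L[ℝ] Vec d := fderiv ℝ (gradient f) x

/-- `‖v‖_H = √(vᵀ H v)`. -/
def normH (H : Vec d →L[ℝ] Vec d) (v : Vec d) : ℝ := √⟪v, H v⟫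

/-- The quotient `‖p - x^{ν+1}‖_H / ‖p - x^ν‖_H`, in `[0, ∞]`: here `0 / 0 = 0`, and `c / 0 = ∞`
for `c > 0`. -/
def Trace.errorRatio (t : Trace d ι) (H : Vec d →L[ℝ] Vec d) (p : Vec d) (ν : ℕ) : ℝ≥0∞ :=
  ENNReal.ofReal (normH H (p - t.x (ν + 1))) / ENNReal.ofReal (normH H (p - t.x ν))

end ProjectForget

end

/-! The method is coordinate ascent on the dual problem. Every point `x` of a run satisfies `∇f x =
-∑ zᵢ aᵢ` with `z ≥ 0`, so it minimizes the Lagrangian at `z`, and `D_f(u, x)` plus the dual value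
`lagrangian f a b x z` equals the Lagrangian at `u` (`IsDualPair.bregmanDist_add_lagrangian`). A
projection raises the dual value by at least the Bregman length of the step
(`IsDualPair.lagrangian_add_le`). Weak duality bounds this value, so the steps tend to zero.

Hence returned constraints become almost satisfied and constraints with nonzero multipliers almost
tight. Either oracle then drives all violations to zero: through `φ` in the deterministic case,
through a conditional Borel-Cantelli argument in the random one. A limit point is therefore feasible
and complementary to the multipliers, so the duality gap closes and the point is optimal
(`Trace.IsRun.convergesTo`). No dual solution and no convergence of the multipliers is needed.

For the rate, complementarity at `xs` gives `D_f(xs, x^(ν+1)) + ∑ D_f(steps) ≤ D_f(xs, x^ν)` for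
large `ν`. The new error is at most a constant times the length of the iteration
(`exists_norm_sub_le_mul_sum`), so the decrease is a fixed fraction of the new squared error. The
constants do not involve the oracle, which serves only to give convergence. -/

namespace ProjectForget

variable {d : ℕ} {f : Vec d → ℝ} {S : Set (Vec d)}

/-! ### Bregman distances -/

theorem bregmanDist_add_bregmanDist (f : Vec d → ℝ) (x y : Vec d) :
    bregmanDist f x y + bregmanDist f y x = ⟪gradient f x - gradient f y, x - y⟫ := by
  simp only [bregmanDist, inner_sub_left, inner_sub_right]
  ring

namespace IsBregmanFunction

/-- Convexity bounds the difference quotients at `y` towards `x` by `f x - f y`; only one-sided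
quotients stay on the segment. -/
theorem bregmanDist_nonneg (hf : IsBregmanFunction f S) {x y : Vec d} (hx : x ∈ closure S)
    (hy : y ∈ S) : 0 ≤ bregmanDist f x y := by
  have hg : HasFDerivAt f (InnerProductSpace.toDual ℝ _ (gradient f y)) y :=
    (hf.differentiableAt y hy).hasGradientAt.hasFDerivAt
  have hl : HasDerivAt (fun t : ℝ => f (y + t • (x - y))) ⟪gradient f y, x - y⟫ 0 := by
    have h1 : HasDerivAt (fun t : ℝ => y + t • (x - y)) (x - y) 0 := by
      simpa using ((hasDerivAt_id (0 : ℝ)).smul_const (x - y)).const_add y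
    have h2 : HasFDerivAt f (InnerProductSpace.toDual ℝ _ (gradient f y))
        (y + (0 : ℝ) • (x - y)) := by simpa using hg
    rw [← InnerProductSpace.toDual_apply_apply (𝕜 := ℝ)]
    exact h2.comp_hasDerivAt (0 : ℝ) h1
  have ht := hl.tendsto_slope_zero_right
  have hle : ⟪gradient f y, x - y⟫ ≤ f x - f y := by
    refine le_of_tendsto ht ?_
    filter_upwards [Ioo_mem_nhdsGT (zero_lt_one (α := ℝ))] with t ht
    have hc := hf.strictConvexOn.convexOn.2 (subset_closure hy) hx
      (sub_nonneg.2 ht.2.le) ht.1.le (sub_add_cancel 1 t)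
    have he : (1 - t) • y + t • x = y + t • (x - y) := by module
    rw [he] at hc
    simp only [zero_add, zero_smul, add_zero, smul_eq_mul] at hc ⊢
    rw [inv_mul_le_iff₀ ht.1]
    linarith
  unfold bregmanDist
  linarith

/-- If `x ≠ y`, strict convexity would make the Bregman distance from the midpoint to `y` negative.
-/
theorem eq_of_bregmanDist_nonpos (hf : IsBregmanFunction f S) {x y : Vec d} (hx : x ∈ closure S)
    (hy : y ∈ S) (h : bregmanDist f x y ≤ 0) : x = y := by
  by_contra hne
  have hc := hf.strictConvexOn.2 hx (subset_closure hy) hne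
    (one_half_pos (α := ℝ)) one_half_pos (add_halves 1)
  have hm := hf.strictConvexOn.1 hx (subset_closure hy)
    (one_half_pos (α := ℝ)).le one_half_pos.le (add_halves 1)
  have h0 := hf.bregmanDist_nonneg hm hy
  unfold bregmanDist at h h0
  have he : (1 / 2 : ℝ) • x + (1 / 2 : ℝ) • y - y = (1 / 2 : ℝ) • (x - y) := by module
  rw [he, inner_smul_right] at h0
  simp only [smul_eq_mul] at hc
  linarith

theorem eq_of_inner_gradient_sub_nonpos (hf : IsBregmanFunction f S) {x y : Vec d} (hx : x ∈ S)
    (hy : y ∈ S) (h : ⟪gradient f x - gradient f y, x - y⟫ ≤ 0) : x = y := by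
  have := hf.bregmanDist_nonneg (subset_closure hy) hx
  rw [← bregmanDist_add_bregmanDist] at h
  exact hf.eq_of_bregmanDist_nonpos (subset_closure hx) hy (by linarith)

theorem inner_gradient_sub_nonneg (hf : IsBregmanFunction f S) {x y : Vec d} (hx : x ∈ S)
    (hy : y ∈ S) : 0 ≤ ⟪gradient f x - gradient f y, x - y⟫ := by
  rw [← bregmanDist_add_bregmanDist]
  exact add_nonneg (hf.bregmanDist_nonneg (subset_closure hx) hy)
    (hf.bregmanDist_nonneg (subset_closure hy) hx)

/-- On bounded sets, a small Bregman distance forces a small distance. -/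
theorem exists_norm_sub_lt (hf : IsBregmanFunction f S) {M : Set (Vec d)}
    (hM : Bornology.IsBounded M) (hMS : M ⊆ S) {ε : ℝ} (hε : 0 < ε) :
    ∃ δ > 0, ∀ x ∈ M, ∀ y ∈ M, bregmanDist f x y < δ → ‖x - y‖ < ε := by
  by_contra! hcon
  choose x hx y hy hD hn using fun n : ℕ => hcon (1 / ((n : ℝ) + 1)) (by positivity)
  obtain ⟨y', -, φ, hφ, hy'⟩ := tendsto_subseq_of_bounded hM hy
  have hD0 : Tendsto (fun n => bregmanDist f (x (φ n)) (y (φ n))) atTop (𝓝 0) := by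
    refine squeeze_zero (fun n => hf.bregmanDist_nonneg (subset_closure (hMS (hx _))) (hMS (hy _)))
      (fun n => (hD (φ n)).le) ?_
    exact tendsto_one_div_add_atTop_nhds_zero_nat.comp hφ.tendsto_atTop
  -- The limit `y'` may lie on the boundary of `S`; the last axiom of a Bregman function still
  -- applies.
  have hx' := hf.tendsto_of_dist (x ∘ φ) (y ∘ φ) y' (fun n => hMS (hy _))
    (fun n => subset_closure (hMS (hx _))) hD0 hy'
    (hM.subset (range_subset_iff.2 fun n => hx _))
  have hlim := (hx'.sub hy').norm
  rw [sub_self, norm_zero] at hlim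
  exact absurd (ge_of_tendsto' hlim fun n => hn (φ n)) (not_le.2 hε)

end IsBregmanFunction

/-! ### Constraints -/

variable {ι : Type*} {a : ι → Vec d} {b : ι → ℝ}

theorem mem_feasible {x : Vec d} : x ∈ feasible a b ↔ ∀ i, ⟪a i, x⟫ ≤ b i := by
  simp [feasible, halfSpace]

theorem isClosed_feasible (a : ι → Vec d) (b : ι → ℝ) : IsClosed (feasible a b) :=
  isClosed_iInter fun i => isClosed_le (by fun_prop) continuous_const

theorem convex_feasible (a : ι → Vec d) (b : ι → ℝ) : Convex ℝ (feasible a b) :=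
  convex_iInter fun i => convex_halfSpace_le (innerₗ (Vec d) (a i)).isLinear (b i)

theorem norm_mul_infDist_halfSpace_le {a : Vec d} (ha : a ≠ 0) {β : ℝ} {x : Vec d} {ε : ℝ}
    (hε : 0 ≤ ε) (h : ⟪a, x⟫ ≤ β + ε) : ‖a‖ * Metric.infDist x (halfSpace a β) ≤ ε := by
  have ha' : 0 < ‖a‖ := norm_pos_iff.2 ha
  have hm : x - (ε / ‖a‖ ^ 2) • a ∈ halfSpace a β := by
    simp only [halfSpace, mem_ofPred_eq, inner_sub_right, inner_smul_right,
      real_inner_self_eq_norm_sq]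
    rw [div_mul_cancel₀ _ (by positivity)]
    linarith
  have hd := Metric.infDist_le_dist_of_mem (x := x) hm
  rw [dist_eq_norm, sub_sub_cancel, norm_smul, Real.norm_of_nonneg (by positivity)] at hd
  calc ‖a‖ * Metric.infDist x (halfSpace a β) ≤ ‖a‖ * (ε / ‖a‖ ^ 2 * ‖a‖) := by gcongr
    _ = ε := by field_simp

/-! ### Optimal points -/

/-- As `∇f x₀ = 0`, `D_f(·, x₀)` is `f` up to a constant, so sublevel sets of `f` in `closure S` are
bounded. -/
theorem IsBregmanFunction.exists_isOptimal (hf : IsBregmanFunction f S)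
    (hfeas : (feasible a b ∩ closure S).Nonempty) (hx₀ : ∃ x₀ ∈ S, gradient f x₀ = 0) :
    ∃ xs, IsOptimal f S a b xs := by
  obtain ⟨x₀, hx₀S, hx₀⟩ := hx₀
  obtain ⟨u, hu⟩ := hfeas
  have hK : IsCompact (feasible a b ∩ closure S ∩ {x | f x ≤ f u}) := by
    refine Metric.isCompact_of_isClosed_isBounded ?_ ?_
    · rw [inter_assoc]
      refine (isClosed_feasible a b).inter ?_
      exact hf.continuousOn.preimage_isClosed_of_isClosed isClosed_closure isClosed_Iic
    · refine (hf.bounded_left x₀ hx₀S (f u - f x₀)).subset fun x hx => ⟨hx.1.2, ?_⟩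
      have := hx.2
      simp only [mem_ofPred_eq] at this
      simp only [bregmanDist, hx₀, inner_zero_left]
      linarith
  obtain ⟨xs, hxs, hmin⟩ := hK.exists_isMinOn ⟨u, hu, le_refl (f u)⟩
    (hf.continuousOn.mono fun x hx => hx.1.2)
  refine ⟨xs, hxs.1, fun x hx => ?_⟩
  rcases le_total (f x) (f u) with h | h
  · exact hmin ⟨hx, h⟩
  · exact (show f xs ≤ f u from hxs.2).trans h

theorem IsBregmanFunction.isOptimal_unique (hf : IsBregmanFunction f S) {p q : Vec d}
    (hp : IsOptimal f S a b p) (hq : IsOptimal f S a b q) : p = q :=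
  (hf.strictConvexOn.subset inter_subset_right
    ((convex_feasible a b).inter hf.convex.closure)).eq_of_isMinOn hp.2 hq.2 hp.1 hq.1

/-! ### Dual pairs -/

section Dual

variable {ι : Type*} [Fintype ι] {a : ι → Vec d} {b : ι → ℝ}

/-- The Lagrangian of the problem of minimizing `f` subject to `⟨a i, x⟩ ≤ b i`. -/
noncomputable def lagrangian (f : Vec d → ℝ) (a : ι → Vec d) (b : ι → ℝ) (x : Vec d) (z : ι → ℝ) : ℝ :=
  f x + ∑ i, z i * (⟪a i, x⟫ - b i)

/-- `x` minimizes the Lagrangian at the multiplier `z ≥ 0`. -/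
structure IsDualPair (f : Vec d → ℝ) (S : Set (Vec d)) (a : ι → Vec d) (x : Vec d) (z : ι → ℝ) :
    Prop where
  mem : x ∈ S
  nonneg : 0 ≤ z
  gradient_eq : gradient f x = -∑ i, z i • a i

/-- The gradient equation cancels the terms linear in `u - x`. Weak duality, complementary slackness
and dual ascent are all read off from this identity. -/
theorem IsDualPair.bregmanDist_add_lagrangian {x : Vec d} {z : ι → ℝ} (h : IsDualPair f S a x z)
    (b : ι → ℝ) (u : Vec d) :
    bregmanDist f u x + lagrangian f a b x z = f u + ∑ i, z i * (⟪a i, u⟫ - b i) := by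
  have h1 : ∑ i, z i * (⟪a i, u⟫ - b i) =
      ∑ i, z i * (⟪a i, x⟫ - b i) + ∑ i, z i * ⟪a i, u - x⟫ := by
    rw [← Finset.sum_add_distrib]
    refine Finset.sum_congr rfl fun i _ => ?_
    rw [inner_sub_right]
    ring
  simp only [bregmanDist, lagrangian, h.gradient_eq, inner_neg_left, sum_inner,
    real_inner_smul_left, h1]
  ring

theorem IsDualPair.bregmanDist_add_lagrangian_le {x : Vec d} {z : ι → ℝ}
    (h : IsDualPair f S a x z) {u : Vec d} (hu : u ∈ feasible a b) :
    bregmanDist f u x + lagrangian f a b x z ≤ f u := by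
  rw [h.bregmanDist_add_lagrangian]
  have : ∑ i, z i * (⟪a i, u⟫ - b i) ≤ 0 := Finset.sum_nonpos fun i _ =>
    mul_nonpos_of_nonneg_of_nonpos (h.nonneg i) (sub_nonpos.2 (mem_feasible.1 hu i))
  linarith

/-- Complementary slackness turns weak duality into an equality; `u` need not be feasible. -/
theorem IsDualPair.bregmanDist_add_lagrangian_eq {x : Vec d} {z : ι → ℝ}
    (h : IsDualPair f S a x z) {u : Vec d} (hu : ∀ i, z i ≠ 0 → ⟪a i, u⟫ = b i) :
    bregmanDist f u x + lagrangian f a b x z = f u := by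
  rw [h.bregmanDist_add_lagrangian, Finset.sum_eq_zero, add_zero]
  intro i _
  rcases eq_or_ne (z i) 0 with hz | hz
  · simp [hz]
  · simp [hu i hz]

theorem IsBregmanFunction.lagrangian_le (hf : IsBregmanFunction f S) {x : Vec d} {z : ι → ℝ}
    (h : IsDualPair f S a x z) {u : Vec d} (hu : u ∈ feasible a b ∩ closure S) :
    lagrangian f a b x z ≤ f u := by
  linarith [h.bregmanDist_add_lagrangian_le hu.1, hf.bregmanDist_nonneg hu.2 h.mem]

theorem ProjectStep.apply_of_ne {f : Vec d → ℝ} {S : Set (Vec d)} {ι : Type*} {a : Vec d} {β : ℝ}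
    {i : ι} {x x' : Vec d} {z z' : ι → ℝ} (h : ProjectStep f S a β i x z x' z') {j : ι}
    (hj : j ≠ i) : z' j = z j := by
  obtain ⟨-, p, -, θ, -, -, -, rfl⟩ := h
  classical exact Function.update_of_ne hj _ _

/-- After a projection step the constraint holds, with equality if its multiplier is nonzero. -/
theorem ProjectStep.inner_le (hf : IsBregmanFunction f S) {ι : Type*} {a : Vec d} {β : ℝ} {i : ι}
    {x x' : Vec d} {z z' : ι → ℝ} (h : ProjectStep f S a β i x z x' z') :
    ⟪a, x'⟫ ≤ β ∧ (z' i ≠ 0 → ⟪a, x'⟫ = β) := by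
  obtain ⟨hx', p, hp, θ, hpa, hθ, hc, rfl⟩ := h
  have hpa : ⟪a, p⟫ = β := hpa
  have hpx : gradient f p - gradient f x' = (θ - min (z i) θ) • a := by
    rw [sub_smul, ← hθ, ← hc]
    abel
  have hin : ⟪gradient f p - gradient f x', p - x'⟫ = (θ - min (z i) θ) * (β - ⟪a, x'⟫) := by
    rw [hpx, real_inner_smul_left, inner_sub_right, hpa]
  rcases le_or_gt θ (z i) with hle | hlt
  -- Full step: `p` and `x'` have the same gradient, hence coincide.
  · rw [min_eq_right hle, sub_self, zero_mul] at hin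
    rw [← hf.eq_of_inner_gradient_sub_nonpos hp hx' hin.le]
    exact ⟨hpa.le, fun _ => hpa⟩
  -- Truncated step: the multiplier drops to zero, and monotonicity of the gradient gives the sign
  -- of `β - ⟪a, x'⟫`.
  · rw [min_eq_left hlt.le] at hin
    have := hf.inner_gradient_sub_nonneg hp hx'
    rw [hin] at this
    refine ⟨sub_nonneg.1 (nonneg_of_mul_nonneg_right this (sub_pos.2 hlt)), fun h => ?_⟩
    simp [min_eq_left hlt.le] at h

theorem IsDualPair.projectStep {x x' : Vec d} {z z' : ι → ℝ} {β : ℝ} {i : ι}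
    (h : IsDualPair f S a x z) (hs : ProjectStep f S (a i) β i x z x' z') :
    IsDualPair f S a x' z' := by
  classical
  have hne : ∀ j ≠ i, z' j = z j := fun j hj => hs.apply_of_ne hj
  obtain ⟨hx', p, -, θ, -, -, hc, hz⟩ := hs
  have hzi : z' i = z i - min (z i) θ := by
    rw [hz]
    exact Function.update_self _ _ _
  refine ⟨hx', fun j => ?_, ?_⟩
  · rcases eq_or_ne j i with rfl | hj
    · simp [hzi]
    · rw [hne j hj]
      exact h.nonneg j
  · have hsum : ∑ j ∈ Finset.univ.erase i, z' j • a j = ∑ j ∈ Finset.univ.erase i, z j • a j :=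
      Finset.sum_congr rfl fun j hj => by rw [hne j (Finset.ne_of_mem_erase hj)]
    rw [sub_eq_iff_eq_add] at hc
    rw [hc, h.gradient_eq, ← Finset.add_sum_erase _ _ (Finset.mem_univ i),
      ← Finset.add_sum_erase Finset.univ (fun j => z' j • a j) (Finset.mem_univ i), hzi,
      hsum]
    module

/-- By the basic identity at `u = x'`, the left side is the Lagrangian at `x'` with the old
multiplier. Passing to `z'` cannot lower it: either `z' i = 0` and the old term is nonpositive, or
the constraint is tight and both terms vanish. -/
theorem IsDualPair.lagrangian_add_le (hf : IsBregmanFunction f S) {x x' : Vec d} {z z' : ι → ℝ}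
    {i : ι} (h : IsDualPair f S a x z) (hs : ProjectStep f S (a i) (b i) i x z x' z') :
    lagrangian f a b x z + bregmanDist f x' x ≤ lagrangian f a b x' z' := by
  classical
  have hin := hs.inner_le hf
  have hle : z' i * (⟪a i, x'⟫ - b i) ≥ z i * (⟪a i, x'⟫ - b i) := by
    rcases eq_or_ne (z' i) 0 with h0 | h0
    · rw [h0, zero_mul]
      exact mul_nonpos_of_nonneg_of_nonpos (h.nonneg i) (sub_nonpos.2 hin.1)
    · simp [hin.2 h0]
  rw [add_comm, h.bregmanDist_add_lagrangian, lagrangian]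
  refine add_le_add_right (Finset.sum_le_sum fun j _ => ?_) _
  rcases eq_or_ne j i with rfl | hj
  · exact hle
  · rw [hs.apply_of_ne hj]

end Dual

/-! ### Runs -/

theorem Trace.norm_sub_le_sum {ι : Type*} (t : Trace d ι) (ν : ℕ) {j k n : ℕ} (hj : j ≤ n) (hk : k ≤ n) :
    ‖t.y ν j - t.y ν k‖ ≤ ∑ m ∈ Finset.range n, ‖t.y ν (m + 1) - t.y ν m‖ := by
  wlog hjk : j ≤ k generalizing j k
  · rw [norm_sub_rev]
    exact this hk hj (by omega)
  rw [norm_sub_rev, ← Finset.sum_Ico_sub (t.y ν) hjk]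
  refine (norm_sum_le _ _).trans (Finset.sum_le_sum_of_subset_of_nonneg (fun m hm => ?_)
    fun _ _ _ => norm_nonneg _)
  simp only [Finset.mem_Ico, Finset.mem_range] at hm ⊢
  omega

namespace Trace.IsRun

variable {ι : Type*} {a : ι → Vec d} {b : ι → ℝ} {ans : ℕ → Finset ι} {t : Trace d ι}

/-- Forgetting is harmless: unprocessed multipliers do not change, so the remembered set always
contains the support of `z`, and each nonzero multiplier is revisited in every iteration. -/
theorem mem_L (ht : t.IsRun f S a b ans) {ν : ℕ} {i : ι} (h : t.z ν i ≠ 0) : i ∈ t.L ν := by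
  have hw : ∀ ν i, i ∉ t.order ν → ∀ k ≤ (t.order ν).length, t.w ν k i = t.z ν i := by
    intro ν i hi k hk
    induction k with
    | zero => rw [ht.w_zero]
    | succ k ih =>
      rw [← ih (by omega), (ht.step ν k hk).apply_of_ne]
      rintro rfl
      exact hi (List.getElem_mem _)
  induction ν with
  | zero => simp [ht.z_zero] at h
  | succ ν ih =>
    refine (ht.mem_L_succ ν i).2 ⟨?_, h⟩
    by_contra hi
    refine hi ((ht.mem_order ν i).2 (Or.inl (ih ?_)))
    rwa [← hw ν i hi _ le_rfl, ← ht.z_succ]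

/-- A constraint with a nonzero multiplier is tight somewhere in the last iteration. -/
theorem exists_inner_eq (ht : t.IsRun f S a b ans) (hf : IsBregmanFunction f S) {ν : ℕ} {i : ι}
    (h : t.z (ν + 1) i ≠ 0) : ∃ k ≤ (t.order ν).length, ⟪a i, t.y ν k⟫ = b i := by
  obtain ⟨k, hk, rfl⟩ := List.getElem_of_mem ((ht.mem_L_succ ν i).1 (ht.mem_L h)).1
  refine ⟨k + 1, hk, ((ht.step ν k hk).inner_le hf).2 ?_⟩
  -- The order has no repetition, so later steps leave this multiplier alone.
  have hw : ∀ m, k + 1 ≤ m → m ≤ (t.order ν).length →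
      t.w ν m (t.order ν)[k] = t.w ν (k + 1) (t.order ν)[k] := by
    intro m hm
    induction m, hm using Nat.le_induction with
    | base => exact fun _ => rfl
    | succ m hm ih =>
      intro hml
      rw [← ih (by omega), (ht.step ν m hml).apply_of_ne]
      rw [Ne, (ht.order_nodup ν).getElem_inj_iff]
      omega
  rwa [← hw _ hk le_rfl, ← ht.z_succ]

/-- A constraint that the oracle returns is satisfied somewhere in the iteration. -/
theorem exists_inner_le (ht : t.IsRun f S a b ans) (hf : IsBregmanFunction f S) {ν : ℕ} {i : ι}
    (h : i ∈ ans ν) : ∃ k ≤ (t.order ν).length, ⟪a i, t.y ν k⟫ ≤ b i := by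
  obtain ⟨k, hk, rfl⟩ := List.getElem_of_mem ((ht.mem_order ν i).2 (Or.inr h))
  exact ⟨k + 1, hk, ((ht.step ν k hk).inner_le hf).1⟩

/-- The constraints with a nonzero multiplier are almost tight after an iteration. -/
theorem abs_inner_sub_le (ht : t.IsRun f S a b ans) (hf : IsBregmanFunction f S) {ν : ℕ} {i : ι}
    (h : t.z (ν + 1) i ≠ 0) : |⟪a i, t.x (ν + 1)⟫ - b i| ≤
      ‖a i‖ * ∑ m ∈ Finset.range (t.order ν).length, ‖t.y ν (m + 1) - t.y ν m‖ := by
  obtain ⟨k, hk, hki⟩ := ht.exists_inner_eq hf h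
  rw [← hki, ← inner_sub_right, ht.x_succ]
  refine (abs_real_inner_le_norm _ _).trans ?_
  gcongr
  exact t.norm_sub_le_sum ν le_rfl hk

variable [Fintype ι]

theorem isDualPair (ht : t.IsRun f S a b ans) (ν : ℕ) : IsDualPair f S a (t.x ν) (t.z ν) ∧
    ∀ k ≤ (t.order ν).length, IsDualPair f S a (t.y ν k) (t.w ν k) := by
  have hin : ∀ ν, IsDualPair f S a (t.x ν) (t.z ν) →
      ∀ k ≤ (t.order ν).length, IsDualPair f S a (t.y ν k) (t.w ν k) := by
    intro ν h k hk
    induction k with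
    | zero => rwa [ht.y_zero, ht.w_zero]
    | succ k ih => exact (ih (by omega)).projectStep (ht.step ν k hk)
  have hx : IsDualPair f S a (t.x ν) (t.z ν) := by
    induction ν with
    | zero => exact ⟨ht.x_zero_mem, by simp [ht.z_zero], by simp [ht.z_zero, ht.gradient_x_zero]⟩
    | succ ν ih =>
      rw [ht.x_succ, ht.z_succ]
      exact hin ν ih _ le_rfl
  exact ⟨hx, hin ν hx⟩

/-- The dual objective increases by at least the Bregman lengths of the steps. -/
theorem lagrangian_add_sum_le (ht : t.IsRun f S a b ans) (hf : IsBregmanFunction f S) (ν : ℕ)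
    {k : ℕ} (hk : k ≤ (t.order ν).length) :
    lagrangian f a b (t.x ν) (t.z ν) +
        ∑ j ∈ Finset.range k, bregmanDist f (t.y ν (j + 1)) (t.y ν j) ≤
      lagrangian f a b (t.y ν k) (t.w ν k) := by
  induction k with
  | zero => simp [ht.y_zero, ht.w_zero]
  | succ k ih =>
    have h1 := ih (by omega)
    have h2 := ((ht.isDualPair ν).2 k (by omega)).lagrangian_add_le hf (ht.step ν k hk)
    rw [Finset.sum_range_succ]
    linarith

theorem bregmanDist_step_nonneg (ht : t.IsRun f S a b ans) (hf : IsBregmanFunction f S) {ν k : ℕ}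
    (hk : k < (t.order ν).length) : 0 ≤ bregmanDist f (t.y ν (k + 1)) (t.y ν k) :=
  hf.bregmanDist_nonneg (subset_closure ((ht.isDualPair ν).2 _ hk).mem)
    ((ht.isDualPair ν).2 _ hk.le).mem

theorem lagrangian_le_inner (ht : t.IsRun f S a b ans) (hf : IsBregmanFunction f S) (ν : ℕ)
    {k : ℕ} (hk : k ≤ (t.order ν).length) :
    lagrangian f a b (t.x ν) (t.z ν) ≤ lagrangian f a b (t.y ν k) (t.w ν k) := by
  refine le_trans (le_add_of_nonneg_right (Finset.sum_nonneg fun j hj => ?_))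
    (ht.lagrangian_add_sum_le hf ν hk)
  exact ht.bregmanDist_step_nonneg hf (by have := Finset.mem_range.1 hj; omega)

theorem monotone_lagrangian (ht : t.IsRun f S a b ans) (hf : IsBregmanFunction f S) :
    Monotone fun ν => lagrangian f a b (t.x ν) (t.z ν) := by
  refine monotone_nat_of_le_succ fun ν => ?_
  rw [ht.x_succ, ht.z_succ]
  exact ht.lagrangian_le_inner hf ν le_rfl

theorem length_order_le (ht : t.IsRun f S a b ans) (ν : ℕ) :
    (t.order ν).length ≤ Fintype.card ι :=
  (ht.order_nodup ν).length_le_card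

/-- The points of a run lie in a bounded subset of `S`. -/
theorem exists_isBounded (ht : t.IsRun f S a b ans) (hf : IsBregmanFunction f S)
    (hfeas : (feasible a b ∩ closure S).Nonempty) :
    ∃ M ⊆ S, Bornology.IsBounded M ∧ ∀ ν, ∀ k ≤ (t.order ν).length, t.y ν k ∈ M := by
  obtain ⟨u, hu⟩ := hfeas
  -- The dual value never falls below its initial value, so weak duality bounds `D_f(u, ·)` along
  -- the run.
  refine ⟨{y | y ∈ S ∧ bregmanDist f u y ≤ f u - lagrangian f a b (t.x 0) (t.z 0)},
    fun y hy => hy.1, hf.bounded_right u hu.2 _, fun ν k hk => ?_⟩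
  have hp := (ht.isDualPair ν).2 k hk
  refine ⟨hp.mem, ?_⟩
  have h1 := hp.bregmanDist_add_lagrangian_le hu.1
  have h2 := ht.lagrangian_le_inner hf ν hk
  have h3 := ht.monotone_lagrangian hf (Nat.zero_le ν)
  simp only at h3
  linarith

/-- The steps tend to zero. -/
theorem eventually_norm_step_lt (ht : t.IsRun f S a b ans) (hf : IsBregmanFunction f S)
    (hfeas : (feasible a b ∩ closure S).Nonempty) {ε : ℝ} (hε : 0 < ε) :
    ∀ᶠ ν in atTop, ∀ k < (t.order ν).length, ‖t.y ν (k + 1) - t.y ν k‖ < ε := by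
  obtain ⟨M, hMS, hM, hyM⟩ := ht.exists_isBounded hf hfeas
  obtain ⟨δ, hδ, hδM⟩ := hf.exists_norm_sub_lt hM hMS hε
  obtain ⟨u, hu⟩ := hfeas
  -- Dual values are monotone and bounded, so their increments tend to zero; each increment
  -- dominates every single Bregman step of its iteration.
  have hL := tendsto_atTop_ciSup (ht.monotone_lagrangian (b := b) hf)
    ⟨f u, by rintro _ ⟨ν, rfl⟩; exact hf.lagrangian_le (ht.isDualPair ν).1 hu⟩
  have hd := (hL.comp (tendsto_add_atTop_nat 1)).sub hL
  rw [sub_self] at hd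
  filter_upwards [hd.eventually_lt_const hδ] with ν hν k hk
  refine hδM _ (hyM ν _ hk) _ (hyM ν k hk.le) (lt_of_le_of_lt ?_ hν)
  have h1 := ht.lagrangian_add_sum_le hf ν le_rfl
  have h2 := Finset.single_le_sum
    (f := fun j => bregmanDist f (t.y ν (j + 1)) (t.y ν j))
    (fun j hj => ht.bregmanDist_step_nonneg hf (Finset.mem_range.1 hj)) (Finset.mem_range.2 hk)
  rw [← ht.x_succ, ← ht.z_succ] at h1
  simp only [Function.comp]
  linarith

/-- All points of an iteration are eventually close to each other. -/
theorem eventually_norm_sub_lt (ht : t.IsRun f S a b ans) (hf : IsBregmanFunction f S)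
    (hfeas : (feasible a b ∩ closure S).Nonempty) {ε : ℝ} (hε : 0 < ε) :
    ∀ᶠ ν in atTop, ∀ j ≤ (t.order ν).length, ∀ k ≤ (t.order ν).length,
      ‖t.y ν j - t.y ν k‖ < ε := by
  have hε' : 0 < ε / (Fintype.card ι + 1) := by positivity
  filter_upwards [ht.eventually_norm_step_lt hf hfeas hε'] with ν hν j hj k hk
  calc ‖t.y ν j - t.y ν k‖
      ≤ ∑ m ∈ Finset.range (t.order ν).length, ‖t.y ν (m + 1) - t.y ν m‖ :=
        t.norm_sub_le_sum ν hj hk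
    _ ≤ ∑ m ∈ Finset.range (t.order ν).length, ε / (Fintype.card ι + 1) :=
        Finset.sum_le_sum fun m hm => (hν m (Finset.mem_range.1 hm)).le
    _ = (t.order ν).length * (ε / (Fintype.card ι + 1)) := by simp
    _ ≤ Fintype.card ι * (ε / (Fintype.card ι + 1)) := by
        gcongr
        exact ht.length_order_le ν
    _ < ε := by
        rw [mul_div_assoc', div_lt_iff₀ (by positivity)]
        linarith

/-- Near the end of a run, only constraints that are tight at a limit point `p` have nonzero
multipliers. -/
theorem eventually_inner_eq (ht : t.IsRun f S a b ans) (hf : IsBregmanFunction f S)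
    (hfeas : (feasible a b ∩ closure S).Nonempty) {l : Filter ℕ} (hl : l ≤ atTop) {p : Vec d}
    (hp : Tendsto t.x l (𝓝 p)) : ∀ᶠ ν in l, ∀ i, t.z ν i ≠ 0 → ⟪a i, p⟫ = b i := by
  rw [eventually_all]
  intro i
  by_cases hi : ⟪a i, p⟫ = b i
  · exact Eventually.of_forall fun _ _ => hi
  have hpos : 0 < |⟪a i, p⟫ - b i| := abs_pos.2 (sub_ne_zero.2 hi)
  have hε : 0 < |⟪a i, p⟫ - b i| / (2 * (‖a i‖ + 1)) := by positivity
  have h1 : Tendsto (fun ν => |⟪a i, t.x ν⟫ - b i|) l (𝓝 |⟪a i, p⟫ - b i|) :=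
    ((((innerSL ℝ (a i)).continuous.tendsto p).comp hp).sub_const _).abs
  filter_upwards [h1.eventually_const_lt (half_lt_self hpos), hl (eventually_ge_atTop 1),
    hl ((tendsto_sub_atTop_nat 1).eventually (ht.eventually_norm_sub_lt hf hfeas hε))]
    with ν h1 h2 h3 hz
  exfalso
  -- A multiplier in `z ν` was made tight during iteration `ν - 1`, which ends at `x ν`.
  obtain ⟨ν, rfl⟩ : ∃ μ, ν = μ + 1 := ⟨ν - 1, by omega⟩
  obtain ⟨k, hk, hki⟩ := ht.exists_inner_eq hf hz
  have h4 := h3 _ le_rfl k hk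
  rw [Nat.add_sub_cancel, ← ht.x_succ, lt_div_iff₀ (by positivity)] at h4
  have h5 : |⟪a i, t.x (ν + 1)⟫ - b i| ≤ ‖a i‖ * ‖t.x (ν + 1) - t.y ν k‖ := by
    rw [← hki, ← inner_sub_right]
    exact abs_real_inner_le_norm _ _
  nlinarith [norm_nonneg (t.x (ν + 1) - t.y ν k)]

/-- If the constraint violations tend to zero, then so does the distance to the optimal point. -/
theorem convergesTo (ht : t.IsRun f S a b ans) (hf : IsBregmanFunction f S) {xs : Vec d}
    (hxs : IsOptimal f S a b xs)
    (hviol : ∀ i, ∀ ε > 0, ∀ᶠ ν in atTop, ⟪a i, t.x ν⟫ ≤ b i + ε) : t.ConvergesTo xs := by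
  have hfeas : (feasible a b ∩ closure S).Nonempty := ⟨xs, hxs.1⟩
  obtain ⟨M, hMS, hM, hyM⟩ := ht.exists_isBounded hf hfeas
  have hxM : ∀ ν, t.x ν ∈ M := fun ν => ht.y_zero ν ▸ hyM ν 0 (Nat.zero_le _)
  have hx : Tendsto t.x atTop (𝓝 xs) := by
    refine tendsto_of_subseq_tendsto fun ns hns => ?_
    obtain ⟨xb, hxbM, φ, hφ, hlim⟩ := tendsto_subseq_of_bounded hM fun n => hxM (ns n)
    refine ⟨φ, ?_⟩
    have hψ : Tendsto (ns ∘ φ) atTop atTop := hns.comp hφ.tendsto_atTop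
    have hxbS : xb ∈ closure S := closure_mono hMS hxbM
    have hxbC : xb ∈ feasible a b := by
      refine mem_feasible.2 fun i => le_of_forall_pos_le_add fun ε hε => ?_
      have h1 : Tendsto (fun n => ⟪a i, t.x (ns (φ n))⟫) atTop (𝓝 ⟪a i, xb⟫) :=
        ((innerSL ℝ (a i)).continuous.tendsto xb).comp hlim
      exact le_of_tendsto h1 (hψ.eventually (hviol i ε hε))
    have hslack : ∀ᶠ n in atTop, ∀ i, t.z (ns (φ n)) i ≠ 0 → ⟪a i, xb⟫ = b i :=
      ht.eventually_inner_eq (l := map (ns ∘ φ) atTop) hf hfeas hψ (tendsto_map'_iff.2 hlim)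
    have hD : Tendsto (fun n => bregmanDist f xb (t.x (ns (φ n)))) atTop (𝓝 0) :=
      hf.tendsto_dist _ _ (fun n => hMS (hxM _)) hlim
    -- By slackness `f xb` is the Bregman distance to `xb` plus the dual value; the former tends to
    -- zero and the latter is at most `f xs`.
    have hle : f xb ≤ f xs := by
      have : Tendsto (fun n => f xs + bregmanDist f xb (t.x (ns (φ n)))) atTop (𝓝 (f xs + 0)) :=
        tendsto_const_nhds.add hD
      rw [add_zero] at this
      refine ge_of_tendsto this ?_
      filter_upwards [hslack] with n hn
      have h1 := ((ht.isDualPair (ns (φ n))).1).bregmanDist_add_lagrangian_eq hn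
      have h2 := hf.lagrangian_le (ht.isDualPair (ns (φ n))).1 hxs.1
      linarith
    have hxb : IsOptimal f S a b xb := ⟨⟨hxbC, hxbS⟩, fun u hu => hle.trans (hxs.2 hu)⟩
    rw [← hf.isOptimal_unique hxb hxs]
    exact hlim
  refine ⟨hx, fun ε hε => ?_⟩
  filter_upwards [ht.eventually_norm_sub_lt hf hfeas (half_pos hε),
    Metric.tendsto_nhds.1 hx _ (half_pos hε)] with ν h1 h2 k hk
  have h3 := h1 k hk 0 (Nat.zero_le _)
  rw [ht.y_zero] at h3
  rw [dist_eq_norm] at h2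
  linarith [norm_sub_le_norm_sub_add_norm_sub (t.y ν k) (t.x ν) xs]

/-- A violated constraint is eventually not returned by the oracle. -/
theorem eventually_inner_le_of_mem (ht : t.IsRun f S a b ans) (hf : IsBregmanFunction f S)
    (hfeas : (feasible a b ∩ closure S).Nonempty) (i : ι) {ε : ℝ} (hε : 0 < ε) :
    ∀ᶠ ν in atTop, i ∈ ans ν → ⟪a i, t.x ν⟫ < b i + ε := by
  have hε' : 0 < ε / (‖a i‖ + 1) := by positivity
  filter_upwards [ht.eventually_norm_sub_lt hf hfeas hε'] with ν hν hi
  obtain ⟨k, hk, hki⟩ := ht.exists_inner_le hf hi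
  have h1 := hν 0 (Nat.zero_le _) k hk
  rw [ht.y_zero, lt_div_iff₀ (by positivity)] at h1
  have h2 : ⟪a i, t.x ν⟫ - ⟪a i, t.y ν k⟫ ≤ ‖a i‖ * ‖t.x ν - t.y ν k‖ := by
    rw [← inner_sub_right]
    exact real_inner_le_norm _ _
  nlinarith [norm_nonneg (t.x ν - t.y ν k)]

/-- Convergence for deterministic oracles. -/
theorem convergesTo_of_isDeterministicOracle {Q : Vec d → Finset ι}
    (ht : t.IsRun f S a b fun ν => Q (t.x ν)) (hf : IsBregmanFunction f S) (ha : ∀ i, a i ≠ 0)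
    (hQ : IsDeterministicOracle a b Q) {xs : Vec d} (hxs : IsOptimal f S a b xs) :
    t.ConvergesTo xs := by
  have hfeas : (feasible a b ∩ closure S).Nonempty := ⟨xs, hxs.1⟩
  obtain ⟨φ, -, hφpos, hφmono, -, hQ⟩ := hQ
  refine ht.convergesTo hf hxs fun i ε hε => ?_
  have hai := norm_pos_iff.2 (ha i)
  have hδ : 0 < ε / ‖a i‖ := by positivity
  -- The factor `1 / 2` puts every returned half-space within half of `φ (ε / ‖a i‖)`. A violation
  -- of constraint `i` by more than `ε` would make the oracle return one at least `φ (ε / ‖a i‖)`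
  -- away.
  have hev : ∀ᶠ ν in atTop, ∀ j, j ∈ Q (t.x ν) →
      ⟪a j, t.x ν⟫ < b j + ‖a j‖ * φ (ε / ‖a i‖) / 2 := by
    rw [eventually_all]
    exact fun j => ht.eventually_inner_le_of_mem hf hfeas j
      (by have := hφpos _ hδ; have := norm_pos_iff.2 (ha j); positivity)
  filter_upwards [hev] with ν hν
  by_contra! hcon
  have hfar : ε / ‖a i‖ ≤ Metric.infDist (t.x ν) (feasible a b) := by
    refine (Metric.le_infDist ⟨xs, hxs.1.1⟩).2 fun y hy => ?_
    have h1 : ⟪a i, t.x ν⟫ - ⟪a i, y⟫ ≤ ‖a i‖ * ‖t.x ν - y‖ := by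
      rw [← inner_sub_right]
      exact real_inner_le_norm _ _
    rw [dist_eq_norm, div_le_iff₀ hai]
    linarith [mem_feasible.1 hy i]
  obtain ⟨j, hj, hφj⟩ := hQ (t.x ν) fun hmem => by linarith [mem_feasible.1 hmem i]
  have h2 := hφmono hδ.le (hδ.le.trans hfar) hfar
  have haj := norm_pos_iff.2 (ha j)
  have h4 : 0 < ‖a j‖ * φ (ε / ‖a i‖) := mul_pos haj (hφpos _ hδ)
  have h3 := norm_mul_infDist_halfSpace_le (ha j) (half_pos h4).le (hν j hj).le
  have h5 : ‖a j‖ * φ (ε / ‖a i‖) ≤ ‖a j‖ * Metric.infDist (t.x ν) (halfSpace (a j) (b j)) := by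
    gcongr
    exact h2.trans hφj
  linarith

end Trace.IsRun

/-! ### Random oracles -/

section Random

variable {Ω : Type*} [mΩ : MeasurableSpace Ω] {P : Measure Ω}

variable {ι : Type*} [Fintype ι] {a : ι → Vec d} {b : ι → ℝ} {Q : Vec d → PMF (Finset ι)}
  {F : Filtration ℕ mΩ} {ans : ℕ → Ω → Finset ι} {t : Ω → Trace d ι}

theorem IsRandomRun.measurableSet_mem (ht : IsRandomRun P f S a b Q F ans t) (ν : ℕ) (i : ι) :
    MeasurableSet[F (ν + 1)] {ω | i ∈ ans ν ω} := by
  have : {ω | i ∈ ans ν ω} = ⋃ A ∈ {A : Finset ι | i ∈ A}, {ω | ans ν ω = A} := by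
    ext ω
    simp
  rw [this]
  exact MeasurableSet.biUnion (Set.to_countable _) fun A _ => ht.measurable_ans ν A

variable [IsProbabilityMeasure P]

/-- A consequence of Lévy's extension of the Borel-Cantelli lemmas: if the conditional probability
of `A ν` given `F ν` is bounded below, and the events `B ν` of `F ν` happen infinitely often, then
`B ν` and `A ν` happen together infinitely often. -/
theorem ae_frequently_of_le_condExp {Ω : Type*} [mΩ : MeasurableSpace Ω] {P : Measure Ω}
    [IsProbabilityMeasure P] {F : Filtration ℕ mΩ} {A B : ℕ → Set Ω}
    (hA : ∀ ν, MeasurableSet[F (ν + 1)] (A ν)) (hB : ∀ ν, MeasurableSet[F ν] (B ν))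
    {τ : ℝ} (hτ : 0 < τ) (hle : ∀ ν, ∀ᵐ ω ∂P, τ ≤ (P[(A ν).indicator (1 : Ω → ℝ) | F ν]) ω) :
    ∀ᵐ ω ∂P, (∃ᶠ ν in atTop, ω ∈ B ν) → ∃ᶠ ν in atTop, ω ∈ B ν ∧ ω ∈ A ν := by
  -- The index shift makes `s` adapted: the answer `A ν` is known only at time `ν + 1`.
  set s : ℕ → Set Ω := fun n => n.casesOn ∅ fun ν => B ν ∩ A ν with hs
  have hsm : ∀ n, MeasurableSet[F n] (s n) := by
    rintro (_ | n)
    · exact @MeasurableSet.empty _ (F 0)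
    · exact (F.mono n.le_succ _ (hB n)).inter (hA n)
  have hcond : ∀ ν, P[(s (ν + 1)).indicator (1 : Ω → ℝ) | F ν] =ᵐ[P]
      (B ν).indicator (P[(A ν).indicator (1 : Ω → ℝ) | F ν]) := by
    intro ν
    have h1 : (s (ν + 1)).indicator (1 : Ω → ℝ) =
        (B ν).indicator ((A ν).indicator (1 : Ω → ℝ)) := by
      rw [Set.indicator_indicator]
    rw [h1]
    refine condExp_indicator ?_ (hB ν)
    exact (integrable_const (1 : ℝ)).indicator (F.le _ _ (hA ν))
  filter_upwards [ae_mem_limsup_atTop_iff P hsm, ae_all_iff.2 hcond, ae_all_iff.2 hle]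
    with ω hiff hcond hle hfreq
  -- `B ν` is known at time `ν`, so its indicator leaves the conditional expectation; each
  -- occurrence of `B ν` contributes at least `τ`.
  have hdiv : Tendsto (fun n => ∑ k ∈ Finset.range n,
      (P[(s (k + 1)).indicator (1 : Ω → ℝ) | F k]) ω) atTop atTop := by
    have hB' : ω ∈ limsup B atTop := by
      rw [mem_limsup_iff_frequently_mem]
      exact hfreq
    rw [Set.limsup_eq_tendsto_sum_indicator_atTop hτ B] at hB'
    refine tendsto_atTop_mono (fun n => Finset.sum_le_sum fun k _ => ?_) hB'
    rw [hcond k]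
    by_cases h : ω ∈ B k
    · simpa [h] using hle k
    · simp [h]
  have := hiff.2 hdiv
  rw [mem_limsup_iff_frequently_mem] at this
  rw [frequently_atTop] at this ⊢
  intro n
  obtain ⟨m, hm, hmem⟩ := this (n + 1)
  obtain ⟨m, rfl⟩ : ∃ m', m = m' + 1 := ⟨m - 1, by omega⟩
  exact ⟨m, by omega, hmem⟩

/-- The conditional probability is a finite sum, over the answers containing `i`, of their
conditional laws. -/
theorem IsRandomRun.le_condExp (ht : IsRandomRun P f S a b Q F ans t) {τ : ℝ≥0∞} (ν : ℕ) (i : ι)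
    (hτ : ∀ x, τ ≤ (Q x).toOuterMeasure {A | i ∈ A}) :
    ∀ᵐ ω ∂P, τ.toReal ≤ (P[{ω | i ∈ ans ν ω}.indicator (1 : Ω → ℝ) | F ν]) ω := by
  classical
  have hsum : {ω | i ∈ ans ν ω}.indicator (1 : Ω → ℝ) =
      ∑ A : Finset ι with i ∈ A, {ω | ans ν ω = A}.indicator (fun _ => (1 : ℝ)) := by
    ext ω
    simp [Finset.sum_apply, Set.indicator_apply]
  have hint : ∀ A : Finset ι, Integrable ({ω | ans ν ω = A}.indicator (fun _ => (1 : ℝ))) P :=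
    fun A => (integrable_const (1 : ℝ)).indicator (F.le _ _ (ht.measurable_ans ν A))
  have h1 := condExp_finsetSum (m := F ν) (s := Finset.univ.filter (i ∈ ·)) fun A _ => hint A
  rw [hsum]
  filter_upwards [h1, ae_all_iff.2 fun A => ht.law_ans ν A] with ω h1 h2
  rw [h1, Finset.sum_apply, Finset.sum_congr rfl fun A _ => h2 A,
    ← ENNReal.toReal_sum fun A _ => PMF.apply_ne_top _ _]
  have hm := hτ ((t ω).x ν)
  have he : {A : Finset ι | i ∈ A} = ↑(Finset.univ.filter fun A : Finset ι => i ∈ A) := by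
    ext A
    simp
  rw [he, PMF.toOuterMeasure_apply_finset] at hm
  exact ENNReal.toReal_mono
    (ENNReal.sum_ne_top.2 fun A _ => PMF.apply_ne_top _ _) hm

/-- Convergence for random oracles. -/
theorem IsRandomRun.ae_convergesTo (ht : IsRandomRun P f S a b Q F ans t)
    (hf : IsBregmanFunction f S) (hQ : IsRandomOracle Q) {xs : Vec d}
    (hxs : IsOptimal f S a b xs) : ∀ᵐ ω ∂P, (t ω).ConvergesTo xs := by
  obtain ⟨τ, hτ, hQ⟩ := hQ
  -- If constraint `i` is violated by `1 / (n + 1)` infinitely often, it is also returned at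
  -- infinitely many of those times, which vanishing steps forbid. Thresholds `1 / (n + 1)` keep the
  -- exceptional sets countable in number.
  have hfreq : ∀ (i : ι) (n : ℕ), ∀ᵐ ω ∂P,
      (∃ᶠ ν in atTop, ω ∈ {ω | b i + 1 / ((n : ℝ) + 1) ≤ ⟪a i, (t ω).x ν⟫}) →
      ∃ᶠ ν in atTop, ω ∈ {ω | b i + 1 / ((n : ℝ) + 1) ≤ ⟪a i, (t ω).x ν⟫} ∧
        ω ∈ {ω | i ∈ ans ν ω} := by
    intro i n
    have hτ1 : τ ≠ ⊤ := by
      refine ne_top_of_le_ne_top ENNReal.one_ne_top ((hQ 0 i).trans ?_)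
      rw [PMF.toOuterMeasure_apply, ← (Q 0).tsum_coe]
      exact ENNReal.tsum_le_tsum fun A => Set.indicator_le_self _ _ _
    refine ae_frequently_of_le_condExp (F := F) (fun ν => ht.measurableSet_mem ν i) (fun ν => ?_)
      (ENNReal.toReal_pos hτ.ne' hτ1) fun ν => ht.le_condExp ν i fun x => hQ x i
    have hm : Measurable[F ν] fun ω => ⟪a i, (t ω).x ν⟫ :=
      (innerSL ℝ (a i)).continuous.measurable.comp (ht.measurable_x ν)
    exact hm measurableSet_Ici
  filter_upwards [ht.isRun, ae_all_iff.2 fun i => ae_all_iff.2 (hfreq i)] with ω hrun hω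
  refine hrun.convergesTo hf hxs fun i ε hε => ?_
  obtain ⟨n, hn⟩ := exists_nat_one_div_lt hε
  by_contra hcon
  rw [not_eventually] at hcon
  obtain ⟨ν, hν⟩ := ((hω i n (hcon.mono fun ν hν => by
    rw [not_le] at hν
    exact (show b i + 1 / ((n : ℝ) + 1) ≤ ⟪a i, (t ω).x ν⟫ by linarith))).and_eventually
      (hrun.eventually_inner_le_of_mem hf ⟨xs, hxs.1⟩ i
        (Nat.one_div_pos_of_nat (α := ℝ) (n := n)))).exists
  have h1 : b i + 1 / ((n : ℝ) + 1) ≤ ⟪a i, (t ω).x ν⟫ := hν.1.1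
  linarith [hν.2 hν.1.2]

end Random

/-! ### The rate of convergence -/

section Hessian

variable {xs : Vec d}

theorem TwiceDifferentiableAt.inner_hessian_comm (h : TwiceDifferentiableAt f xs) (v w : Vec d) :
    ⟪hessian f xs v, w⟫ = ⟪hessian f xs w, v⟫ := by
  have h1 : ∀ᶠ y in 𝓝 xs, HasFDerivAt f (innerSL ℝ (gradient f y)) y :=
    h.1.mono fun y hy => hy.hasGradientAt.hasFDerivAt
  have h2 : HasFDerivAt (fun y => innerSL ℝ (gradient f y))
      ((innerSL ℝ : Vec d →L[ℝ] _).comp (hessian f xs)) xs :=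
    (innerSL ℝ : Vec d →L[ℝ] _).hasFDerivAt.comp xs h.2.hasFDerivAt
  simpa using second_derivative_symmetric_of_eventually_of_real h1 h2 v w

theorem TwiceDifferentiableAt.exists_norm_gradient_sub_le (h : TwiceDifferentiableAt f xs) {ε : ℝ}
    (hε : 0 < ε) : ∃ δ > 0, ∀ x, ‖x - xs‖ < δ →
      ‖gradient f x - gradient f xs - hessian f xs (x - xs)‖ ≤ ε * ‖x - xs‖ := by
  have h1 := h.2.hasFDerivAt.isLittleO.def hε
  obtain ⟨δ, hδ, h2⟩ := Metric.eventually_nhds_iff.1 h1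
  exact ⟨δ, hδ, fun x hx => h2 (by rwa [dist_eq_norm])⟩

/-- Near `xs` the Bregman distance is, to second order, half the squared distance in the norm of the
Hessian. -/
theorem TwiceDifferentiableAt.exists_abs_bregmanDist_sub_le (h : TwiceDifferentiableAt f xs) {ε : ℝ}
    (hε : 0 < ε) : ∃ δ > 0, ∀ r < δ, ∀ x y, ‖x - xs‖ ≤ r → ‖y - xs‖ ≤ r →
      |bregmanDist f x y - 1 / 2 * ⟪x - y, hessian f xs (x - y)⟫| ≤ ε * r ^ 2 := by
  obtain ⟨δ₁, hδ₁, hg⟩ := h.exists_norm_gradient_sub_le (ε := ε / 4) (by positivity)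
  obtain ⟨δ₂, hδ₂, hd⟩ := Metric.eventually_nhds_iff.1 h.1
  refine ⟨min δ₁ δ₂, lt_min hδ₁ hδ₂, fun r hr x y hx hy => ?_⟩
  have hr₁ := hr.trans_le (min_le_left _ _)
  have hr₂ := hr.trans_le (min_le_right _ _)
  have hr0 : 0 ≤ r := (norm_nonneg _).trans hx
  set H := hessian f xs with hH
  -- With `y` fixed, the gradient of `ψ` at `w` is the difference of the first-order remainders at
  -- `w` and `y`, at most `2 * (ε / 4) * r`. The mean value inequality over a chord of length at
  -- most `2 * r` gives `ε * r ^ 2`.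
  set ψ : Vec d → ℝ := fun w => f w - ⟪gradient f y, w - y⟫ - 1 / 2 * ⟪w - y, H (w - y)⟫ with hψ
  have hder : ∀ w ∈ Metric.closedBall xs r, HasFDerivWithinAt ψ
      (innerSL ℝ (gradient f w - gradient f y - H (w - y))) (Metric.closedBall xs r) w := by
    intro w hw
    have h1 : HasFDerivAt f (innerSL ℝ (gradient f w)) w :=
      (hd (lt_of_le_of_lt hw hr₂)).hasGradientAt.hasFDerivAt
    have h0 : HasFDerivAt (fun w => w - y) (ContinuousLinearMap.id ℝ (Vec d)) w :=
      (hasFDerivAt_id w).sub_const y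
    have h2 := (innerSL ℝ (gradient f y)).hasFDerivAt.comp w h0
    have h3 := (h0.inner ℝ (H.hasFDerivAt.comp w h0)).const_mul (1 / 2)
    refine (((h1.sub h2).sub h3).congr_fderiv ?_).hasFDerivWithinAt
    ext v
    have hc := h.inner_hessian_comm (w - y) v
    rw [← hH] at hc
    simp only [sub_apply, smul_apply,
      ContinuousLinearMap.comp_apply, ContinuousLinearMap.prod_apply, fderivInnerCLM_apply,
      innerSL_apply_apply, ContinuousLinearMap.id_apply, inner_sub_left (𝕜 := ℝ) _ _ v,
      smul_eq_mul, Function.comp]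
    rw [real_inner_comm (H v) (w - y), ← hc, real_inner_comm (H (w - y)) v]
    ring
  have hbound : ∀ w ∈ Metric.closedBall xs r,
      ‖innerSL ℝ (gradient f w - gradient f y - H (w - y))‖ ≤ ε / 2 * r := by
    intro w hw
    rw [mem_closedBall_iff_norm] at hw
    have he : gradient f w - gradient f y - H (w - y) =
        (gradient f w - gradient f xs - H (w - xs)) -
          (gradient f y - gradient f xs - H (y - xs)) := by
      simp only [map_sub]
      abel
    rw [innerSL_apply_norm, he]
    refine (norm_sub_le _ _).trans ?_
    have h1 := hg w (hw.trans_lt hr₁)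
    have h2 := hg y (hy.trans_lt hr₁)
    nlinarith
  have hmv := (convex_closedBall xs r).norm_image_sub_le_of_norm_hasFDerivWithin_le hder hbound
    (mem_closedBall_iff_norm.2 hy) (mem_closedBall_iff_norm.2 hx)
  have hψe : ψ x - ψ y = bregmanDist f x y - 1 / 2 * ⟪x - y, H (x - y)⟫ := by
    simp only [hψ, bregmanDist, sub_self, inner_zero_right, inner_zero_left]
    ring
  rw [← hψe, ← Real.norm_eq_abs]
  refine hmv.trans ?_
  have h1 : ‖x - y‖ ≤ 2 * r := by
    have := norm_sub_le_norm_sub_add_norm_sub x xs y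
    rw [norm_sub_rev xs y] at this
    linarith
  calc ε / 2 * r * ‖x - y‖ ≤ ε / 2 * r * (2 * r) := by gcongr
    _ = ε * r ^ 2 := by ring

/-- A positive definite operator is bounded below. -/
theorem exists_mul_sq_le_inner {H : Vec d →L[ℝ] Vec d} (hH : ∀ v, v ≠ 0 → 0 < ⟪v, H v⟫) :
    ∃ μ > 0, ∀ v, μ * ‖v‖ ^ 2 ≤ ⟪v, H v⟫ := by
  -- The sphere is empty when `d = 0`.
  rcases (Metric.sphere (0 : Vec d) 1).eq_empty_or_nonempty with he | hne
  · refine ⟨1, one_pos, fun v => ?_⟩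
    have hv : v = 0 := by
      by_contra hv
      have : ‖v‖⁻¹ • v ∈ Metric.sphere (0 : Vec d) 1 := by
        simp [norm_smul, inv_mul_cancel₀ (norm_ne_zero_iff.2 hv)]
      simp [he] at this
    simp [hv]
  obtain ⟨w, hw, hmin⟩ := (isCompact_sphere (0 : Vec d) 1).exists_isMinOn hne
    (f := fun v => ⟪v, H v⟫) (by fun_prop)
  have hw0 : w ≠ 0 := by
    rintro rfl
    simp at hw
  refine ⟨⟪w, H w⟫, hH w hw0, fun v => ?_⟩
  rcases eq_or_ne v 0 with rfl | hv
  · simp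
  have hv' := norm_pos_iff.2 hv
  have h1 : ⟪w, H w⟫ ≤ ⟪‖v‖⁻¹ • v, H (‖v‖⁻¹ • v)⟫ := hmin (by simp [norm_smul, hv'.ne'])
  rw [map_smul, real_inner_smul_left, real_inner_smul_right] at h1
  calc ⟪w, H w⟫ * ‖v‖ ^ 2 ≤ ‖v‖⁻¹ * (‖v‖⁻¹ * ⟪v, H v⟫) * ‖v‖ ^ 2 := by gcongr
    _ = ⟪v, H v⟫ := by field_simp

theorem inner_apply_le (H : Vec d →L[ℝ] Vec d) (v : Vec d) : ⟪v, H v⟫ ≤ ‖H‖ * ‖v‖ ^ 2 := by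
  calc ⟪v, H v⟫ ≤ ‖v‖ * ‖H v‖ := real_inner_le_norm _ _
    _ ≤ ‖v‖ * (‖H‖ * ‖v‖) := by gcongr; exact H.le_opNorm v
    _ = ‖H‖ * ‖v‖ ^ 2 := by ring

end Hessian

/-! ### Linear combinations of the constraint normals -/

section Combinations

variable {ι : Type*}

/-- The linear combinations of the vectors `a i`, `i ∈ J`. -/
noncomputable def combination (a : ι → Vec d) (J : Finset ι) : (ι → ℝ) →ₗ[ℝ] Vec d :=
  ∑ i ∈ J, (LinearMap.proj i).smulRight (a i)

theorem combination_apply (a : ι → Vec d) (J : Finset ι) (w : ι → ℝ) :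
    combination a J w = ∑ i ∈ J, w i • a i := by
  simp [combination]

variable [Fintype ι]

/-- A vector of the span of `a i`, `i ∈ J`, is almost orthogonal to the vectors that are almost
orthogonal to all these `a i`. -/
theorem exists_abs_inner_le (a : ι → Vec d) : ∃ C ≥ 0, ∀ (J : Finset ι),
    ∀ q ∈ LinearMap.range (combination a J), ∀ (v : Vec d) (s : ℝ), 0 ≤ s →
      (∀ i ∈ J, |⟪a i, v⟫| ≤ s) → |⟪q, v⟫| ≤ C * ‖q‖ * s := by
  classical
  have hJ : ∀ J : Finset ι, ∃ C ≥ 0, ∀ q ∈ LinearMap.range (combination a J),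
      ∀ (v : Vec d) (s : ℝ), 0 ≤ s → (∀ i ∈ J, |⟪a i, v⟫| ≤ s) → |⟪q, v⟫| ≤ C * ‖q‖ * s := by
    intro J
    -- A linear right inverse chooses coefficients bounded by a multiple of `‖q‖`, even for
    -- dependent `a i`; summing over the finitely many `J` makes the constant uniform.
    obtain ⟨G, hG⟩ := (combination a J).rangeRestrict.exists_rightInverse_of_surjective
      (LinearMap.range_rangeRestrict _)
    set G' := LinearMap.toContinuousLinearMap G
    refine ⟨J.card * ‖G'‖, by positivity, fun q hq v s hs hv => ?_⟩
    have hq' : q = ∑ i ∈ J, G' ⟨q, hq⟩ i • a i := by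
      rw [← combination_apply]
      exact congrArg Subtype.val (LinearMap.congr_fun hG ⟨q, hq⟩).symm
    calc |⟪q, v⟫| = |∑ i ∈ J, G' ⟨q, hq⟩ i * ⟪a i, v⟫| := by
          conv_lhs => rw [hq', sum_inner]
          simp only [real_inner_smul_left]
      _ ≤ ∑ i ∈ J, |G' ⟨q, hq⟩ i * ⟪a i, v⟫| := Finset.abs_sum_le_sum_abs _ _
      _ ≤ ∑ i ∈ J, ‖G'‖ * ‖q‖ * s := by
          refine Finset.sum_le_sum fun i hi => ?_
          rw [abs_mul]
          gcongr
          · exact (norm_le_pi_norm (G' ⟨q, hq⟩) i).trans (G'.le_opNorm ⟨q, hq⟩)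
          · exact hv i hi
      _ = J.card * ‖G'‖ * ‖q‖ * s := by
          rw [Finset.sum_const, nsmul_eq_mul]
          ring
  choose C hC hJ using hJ
  refine ⟨∑ J, C J, Finset.sum_nonneg fun J _ => hC J, fun J q hq v s hs hv =>
    (hJ J q hq v s hs hv).trans ?_⟩
  gcongr
  exact Finset.single_le_sum (fun J _ => hC J) (Finset.mem_univ J)

end Combinations

/-! ### Error bound and linear contraction -/

section Rate

variable {ι : Type*} [Fintype ι] {a : ι → Vec d} {b : ι → ℝ} {xs : Vec d}

/-- Near the end of a run, the error is at most a constant times the length of the last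
iteration. -/
theorem exists_norm_sub_le_mul_sum (hf : IsBregmanFunction f S) (hxs : IsOptimal f S a b xs)
    (h2 : TwiceDifferentiableAt f xs) (hpos : ∀ v, v ≠ 0 → 0 < ⟪v, hessian f xs v⟫) :
    ∃ K > 0, ∀ (ans : ℕ → Finset ι) (t : Trace d ι), t.IsRun f S a b ans → t.ConvergesTo xs →
      ∀ᶠ ν in atTop, ‖t.x (ν + 1) - xs‖ ≤
        K * ∑ m ∈ Finset.range (t.order ν).length, ‖t.y ν (m + 1) - t.y ν m‖ := by
  classical
  obtain ⟨μ, hμ, hμH⟩ := exists_mul_sq_le_inner hpos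
  obtain ⟨C, hC, hCJ⟩ := exists_abs_inner_le a
  set H := hessian f xs
  set A := ∑ i, ‖a i‖ with hA
  have hA0 : 0 ≤ A := Finset.sum_nonneg fun _ _ => norm_nonneg _
  refine ⟨2 * C * (‖H‖ + μ / 2) * A / μ + 1, by positivity, fun ans t ht hconv => ?_⟩
  obtain ⟨δ, hδ, hg⟩ := h2.exists_norm_gradient_sub_le (half_pos hμ)
  have hgrad : Tendsto (fun ν => gradient f (t.x ν)) atTop (𝓝 (gradient f xs)) :=
    h2.2.continuousAt.tendsto.comp hconv.1
  -- Spans are closed and there are finitely many of them, so `∇f xs` inherits membership by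
  -- continuity. This replaces a multiplier for `xs`, which may lie outside `S`.
  have hspan : ∀ᶠ ν in atTop, ∀ J : Finset ι,
      gradient f (t.x ν) ∈ LinearMap.range (combination a J) →
        gradient f xs ∈ LinearMap.range (combination a J) := by
    rw [eventually_all]
    intro J
    by_cases hJ : gradient f xs ∈ LinearMap.range (combination a J)
    · exact Eventually.of_forall fun _ _ => hJ
    · have hcl : IsClosed (LinearMap.range (combination a J) : Set (Vec d)) :=
        Submodule.closed_of_finiteDimensional _
      filter_upwards [hgrad.eventually (hcl.isOpen_compl.mem_nhds hJ)] with ν hν h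
      exact absurd h hν
  have hnear : ∀ᶠ ν in atTop, ‖t.x ν - xs‖ < δ := by
    simpa [dist_eq_norm] using (Metric.tendsto_nhds.1 hconv.1) δ hδ
  have hslack := ht.eventually_inner_eq hf ⟨xs, hxs.1⟩ le_rfl hconv.1
  filter_upwards [(tendsto_add_atTop_nat 1).eventually hspan,
    (tendsto_add_atTop_nat 1).eventually hnear, (tendsto_add_atTop_nat 1).eventually hslack]
    with ν hspan hnear hslack
  set s := ∑ m ∈ Finset.range (t.order ν).length, ‖t.y ν (m + 1) - t.y ν m‖
  have hs : 0 ≤ s := Finset.sum_nonneg fun _ _ => norm_nonneg _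
  set v := t.x (ν + 1) - xs with hv
  set J : Finset ι := Finset.univ.filter fun i => t.z (ν + 1) i ≠ 0 with hJ
  have hmem : gradient f (t.x (ν + 1)) ∈ LinearMap.range (combination a J) := by
    refine ⟨-t.z (ν + 1), ?_⟩
    rw [combination_apply, (ht.isDualPair (ν + 1)).1.gradient_eq, ← Finset.sum_neg_distrib,
      hJ, Finset.sum_filter]
    refine Finset.sum_congr rfl fun i _ => ?_
    by_cases hz : t.z (ν + 1) i = 0 <;> simp [hz]
  have hq := Submodule.sub_mem _ hmem (hspan J hmem)
  -- The constraints in `J` are tight at `xs` and almost tight at `x (ν + 1)`, so `v` is almost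
  -- orthogonal to their normals, while the gradient difference lies in their span.
  have hin := hCJ J _ hq v (A * s) (by positivity) fun i hi => by
    have hz : t.z (ν + 1) i ≠ 0 := by simpa [hJ] using hi
    rw [hv, inner_sub_right, hslack i hz]
    refine (ht.abs_inner_sub_le hf hz).trans ?_
    gcongr
    exact Finset.single_le_sum (f := fun i => ‖a i‖) (fun _ _ => norm_nonneg _)
      (Finset.mem_univ i)
  have he : _ ≤ μ / 2 * ‖v‖ := hg _ hnear
  rw [← hv] at he
  set q := gradient f (t.x (ν + 1)) - gradient f xs with hqdef
  have hqn : ‖q‖ ≤ (‖H‖ + μ / 2) * ‖v‖ := by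
    have h1 : ‖q‖ ≤ ‖q - H v‖ + ‖H v‖ := norm_le_norm_sub_add q (H v)
    linarith [H.le_opNorm v]
  -- Half of the lower bound `μ` of the Hessian absorbs the first-order remainder.
  have hqv : μ / 2 * ‖v‖ ^ 2 ≤ ⟪q, v⟫ := by
    have h1 : ⟪q, v⟫ = ⟪v, H v⟫ + ⟪q - H v, v⟫ := by
      rw [inner_sub_left q, real_inner_comm v (H v)]
      ring
    have h3 : |⟪q - H v, v⟫| ≤ μ / 2 * ‖v‖ * ‖v‖ :=
      (abs_real_inner_le_norm _ _).trans (by gcongr)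
    linarith [hμH v, neg_le_of_abs_le h3, sq ‖v‖]
  have hfin : μ / 2 * ‖v‖ ^ 2 ≤ C * ((‖H‖ + μ / 2) * ‖v‖) * (A * s) :=
    (hqv.trans (le_abs_self _)).trans (hin.trans (by gcongr))
  clear_value H v s q A
  rcases (norm_nonneg v).eq_or_lt with h0 | h0
  · rw [← h0]
    positivity
  · have h4 : μ * ‖v‖ ≤ 2 * C * (‖H‖ + μ / 2) * A * s := by
      refine le_of_mul_le_mul_right ?_ h0
      linarith
    have h5 : ‖v‖ ≤ 2 * C * (‖H‖ + μ / 2) * A / μ * s := by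
      rw [div_mul_eq_mul_div, le_div_iff₀ hμ]
      linarith
    linarith

/-- Write `E`, `E'` for the squared `H`-norms of the old and new errors and `T` for the sum of
squared steps. The dual ascent inequality gives `E' + μ T ≤ E + κ/2 E` once `ε` absorbs the
second-order errors, and the error bound with Cauchy-Schwarz gives `κ E' ≤ μ T`. Hence `(1 + κ) E' ≤
(1 + κ/2) E`. -/
theorem exists_limsup_errorRatio_le (hf : IsBregmanFunction f S) (hxs : IsOptimal f S a b xs)
    (h2 : TwiceDifferentiableAt f xs) (hpos : ∀ v, v ≠ 0 → 0 < ⟪v, hessian f xs v⟫) :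
    ∃ ρ : ℝ, 0 < ρ ∧ ρ < 1 ∧ ∀ (ans : ℕ → Finset ι) (t : Trace d ι), t.IsRun f S a b ans →
      t.ConvergesTo xs →
        limsup (t.errorRatio (hessian f xs) xs) atTop ≤ ENNReal.ofReal ρ := by
  obtain ⟨μ, hμ, hμH⟩ := exists_mul_sq_le_inner hpos
  obtain ⟨K, hK, hrun⟩ := exists_norm_sub_le_mul_sum hf hxs h2 hpos
  set H := hessian f xs
  set N : ℝ := (Fintype.card ι : ℝ) with hN
  have hN0 : 0 ≤ N := Nat.cast_nonneg _
  set κ := μ / ((‖H‖ + 1) * K ^ 2 * (N + 1)) with hκ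
  have hκ0 : 0 < κ := by positivity
  -- For points `y` of the iteration, `μ/4 ‖xs - y‖² ≤ D_f(xs, y) ≤ D_f(xs, x^ν) ≤ (‖H‖/2 + μ/4)
  -- ‖v‖²`, whence this ratio.
  set B := (2 * ‖H‖ + μ) / μ with hB
  have hB0 : 0 < B := by positivity
  set ρ := √((1 + κ / 2) / (1 + κ)) with hρ
  have hρ1 : ρ < 1 := by
    rw [hρ, Real.sqrt_lt' one_pos, one_pow, div_lt_one (by positivity)]
    linarith
  refine ⟨ρ, Real.sqrt_pos.2 (by positivity), hρ1, fun ans t ht hconv => ?_⟩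
  set ε := min (μ / 4) (κ * μ / (4 * (B + 1 + N * B))) with hε
  have hε0 : 0 < ε := lt_min (by positivity) (by positivity)
  have hε1 : ε ≤ μ / 4 := min_le_left _ _
  have hε2 : ε * (B + 1 + N * B) ≤ κ * μ / 4 := by
    have : ε ≤ κ * μ / (4 * (B + 1 + N * B)) := min_le_right _ _
    rw [le_div_iff₀ (by positivity)] at this
    linarith
  obtain ⟨δ, hδ, happ⟩ := h2.exists_abs_bregmanDist_sub_le hε0
  -- This radius keeps `r = √B * ‖v‖` below `δ`.
  have hδ' : 0 < δ / (√B + 1) := by positivity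
  refine limsup_le_of_le (h := ?_)
  filter_upwards [hrun ans t ht hconv, hconv.2 _ (lt_min hδ hδ'),
    ht.eventually_inner_eq hf ⟨xs, hxs.1⟩ le_rfl hconv.1] with ν hK hnear hslack
  set n := (t.order ν).length with hn
  have hnN : (n : ℝ) ≤ N := Nat.cast_le.2 (ht.length_order_le ν)
  set v := xs - t.x ν with hv
  set v' := xs - t.x (ν + 1) with hv'
  have hvn : ‖v‖ < δ ∧ ‖v‖ < δ / (√B + 1) := by
    have := hnear 0 (Nat.zero_le _)
    rwa [ht.y_zero, norm_sub_rev, lt_min_iff] at this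
  -- the Bregman distance to `xs` decreases
  have heq := (ht.isDualPair ν).1.bregmanDist_add_lagrangian_eq hslack
  have hup : bregmanDist f xs (t.x ν) ≤ 1 / 2 * ⟪v, H v⟫ + ε * ‖v‖ ^ 2 := by
    have := happ ‖v‖ hvn.1 xs (t.x ν) (by simp) (by rw [norm_sub_rev])
    linarith [le_of_abs_le this]
  have hlow : ∀ k ≤ n, 1 / 2 * ⟪xs - t.y ν k, H (xs - t.y ν k)⟫ - ε * ‖xs - t.y ν k‖ ^ 2 ≤
      bregmanDist f xs (t.y ν k) := by
    intro k hk
    have h1 := (lt_min_iff.1 (hnear k hk)).1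
    rw [norm_sub_rev] at h1
    have := happ ‖xs - t.y ν k‖ h1 xs (t.y ν k) (by simp) (by rw [norm_sub_rev])
    linarith [neg_le_of_abs_le this]
  have hyB : ∀ k ≤ n, ‖xs - t.y ν k‖ ^ 2 ≤ B * ‖v‖ ^ 2 := by
    intro k hk
    have h1 := ((ht.isDualPair ν).2 k hk).bregmanDist_add_lagrangian_le hxs.1.1
    have h3 := ht.lagrangian_le_inner hf ν hk
    have h4 := hlow k hk
    have h5 := hμH (xs - t.y ν k)
    have h6 : ε * ‖xs - t.y ν k‖ ^ 2 ≤ μ / 4 * ‖xs - t.y ν k‖ ^ 2 := by gcongr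
    have h7 : ε * ‖v‖ ^ 2 ≤ μ / 4 * ‖v‖ ^ 2 := by gcongr
    have h8 := inner_apply_le H v
    rw [hB, div_mul_eq_mul_div, le_div_iff₀ hμ]
    linarith
  set r := √B * ‖v‖ with hr
  have hr2 : r ^ 2 = B * ‖v‖ ^ 2 := by rw [hr, mul_pow, Real.sq_sqrt hB0.le]
  have hrδ : r < δ := by
    have := hvn.2
    rw [lt_div_iff₀ (by positivity)] at this
    linarith [norm_nonneg v]
  have hyr : ∀ k ≤ n, ‖t.y ν k - xs‖ ≤ r := by
    intro k hk
    rw [norm_sub_rev]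
    refine le_of_sq_le_sq ?_ (by positivity)
    rw [hr2]
    exact hyB k hk
  have hstep : ∀ k ∈ Finset.range n, μ / 2 * ‖t.y ν (k + 1) - t.y ν k‖ ^ 2 - ε * (B * ‖v‖ ^ 2) ≤
      bregmanDist f (t.y ν (k + 1)) (t.y ν k) := by
    intro k hk
    have hk := Finset.mem_range.1 hk
    have := happ r hrδ _ _ (hyr (k + 1) hk) (hyr k hk.le)
    rw [hr2] at this
    linarith [neg_le_of_abs_le this, hμH (t.y ν (k + 1) - t.y ν k)]
  have hsum := Finset.sum_le_sum hstep
  rw [Finset.sum_sub_distrib, ← Finset.mul_sum, Finset.sum_const, Finset.card_range,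
    nsmul_eq_mul] at hsum
  set T := ∑ k ∈ Finset.range n, ‖t.y ν (k + 1) - t.y ν k‖ ^ 2 with hT
  have hT0 : 0 ≤ T := Finset.sum_nonneg fun _ _ => sq_nonneg _
  have hcs : (∑ k ∈ Finset.range n, ‖t.y ν (k + 1) - t.y ν k‖) ^ 2 ≤ n * T := by
    simpa using sq_sum_le_card_mul_sum_sq (s := Finset.range n)
      (f := fun k => ‖t.y ν (k + 1) - t.y ν k‖)
  have hv'T : κ * ⟪v', H v'⟫ ≤ μ * T := by
    rw [norm_sub_rev] at hK
    have h1 : ‖v'‖ ^ 2 ≤ K ^ 2 * (n * T) := by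
      refine (pow_le_pow_left₀ (norm_nonneg _) hK 2).trans ?_
      rw [mul_pow]
      gcongr
    have h3 : ⟪v', H v'⟫ ≤ (‖H‖ + 1) * (K ^ 2 * ((N + 1) * T)) := by
      refine (inner_apply_le H v').trans ?_
      have : n * T ≤ (N + 1) * T := by gcongr; linarith
      gcongr
      · linarith
      · exact h1.trans (by gcongr)
    calc κ * ⟪v', H v'⟫ ≤ κ * ((‖H‖ + 1) * (K ^ 2 * ((N + 1) * T))) := by gcongr
      _ = μ * T := by
        rw [hκ]
        field_simp
  have hdec := ht.lagrangian_add_sum_le hf ν le_rfl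
  have hend := ((ht.isDualPair ν).2 n le_rfl).bregmanDist_add_lagrangian_le hxs.1.1
  have hlown := hlow n le_rfl
  have hyn := hyB n le_rfl
  rw [hn, ← ht.x_succ, ← hv'] at hlown hyn
  rw [hn, ← ht.x_succ, ← ht.z_succ] at hend
  rw [← ht.x_succ, ← ht.z_succ] at hdec
  have h5 : ε * ‖v'‖ ^ 2 ≤ ε * (B * ‖v‖ ^ 2) := by gcongr
  have h6 : n * (ε * (B * ‖v‖ ^ 2)) ≤ N * (ε * (B * ‖v‖ ^ 2)) := by gcongr
  have h7 : ε * (B + 1 + N * B) * ‖v‖ ^ 2 ≤ κ * μ / 4 * ‖v‖ ^ 2 := by gcongr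
  have h8 : κ / 4 * (μ * ‖v‖ ^ 2) ≤ κ / 4 * ⟪v, H v⟫ := by gcongr; exact hμH v
  have hmain : (1 + κ) * ⟪v', H v'⟫ ≤ (1 + κ / 2) * ⟪v, H v⟫ := by linarith
  have hnorm : normH H v' ≤ ρ * normH H v := by
    rw [normH, normH, hρ, ← Real.sqrt_mul (by positivity)]
    refine Real.sqrt_le_sqrt ?_
    rw [div_mul_eq_mul_div, le_div_iff₀ (by positivity)]
    linarith
  rw [Trace.errorRatio]
  -- The product form covers a zero denominator, where the numerator vanishes too.
  refine ENNReal.div_le_of_le_mul ?_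
  rw [← ENNReal.ofReal_mul (Real.sqrt_nonneg _)]
  exact ENNReal.ofReal_le_ofReal hnorm

end Rate

end ProjectForget

theorem mainTheorem1 {d : ℕ} {ι : Type u} [Finite ι]
    (f : ProjectForget.Vec d → ℝ) (S : Set (ProjectForget.Vec d))
    (a : ι → ProjectForget.Vec d) (b : ι → ℝ)
    (hf : ProjectForget.IsBregmanFunction f S)
    (ha : ∀ i, a i ≠ 0)
    (hzone : ∀ i, ProjectForget.StronglyZoneConsistent f S (a i) (b i))
    (hfeas : (ProjectForget.feasible a b ∩ closure S).Nonempty)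
    (hx₀ : ∃ x₀ ∈ S, gradient f x₀ = 0) :
    ∃ xs : ProjectForget.Vec d,
      (ProjectForget.IsOptimal f S a b xs ∧
        ∀ p, ProjectForget.IsOptimal f S a b p → p = xs) ∧
      -- Part 1
      (∀ Q : ProjectForget.Vec d → Finset ι, ProjectForget.IsDeterministicOracle a b Q →
        ∀ t : ProjectForget.Trace d ι, ProjectForget.IsDeterministicRun f S a b Q t →
          t.ConvergesTo xs) ∧
      (∀ Q : ProjectForget.Vec d → PMF (Finset ι), ProjectForget.IsRandomOracle Q →
        ∀ (Ω : Type v) [mΩ : MeasurableSpace Ω] (P : Measure Ω) [IsProbabilityMeasure P]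
          (F : Filtration ℕ mΩ) (ans : ℕ → Ω → Finset ι) (t : Ω → ProjectForget.Trace d ι),
          ProjectForget.IsRandomRun P f S a b Q F ans t →
            ∀ᵐ ω ∂P, (t ω).ConvergesTo xs) ∧
      -- Part 2
      (ProjectForget.TwiceDifferentiableAt f xs →
        (∀ v, v ≠ 0 → 0 < ⟪v, ProjectForget.hessian f xs v⟫) →
        ∃ ρ : ℝ, 0 < ρ ∧ ρ < 1 ∧
          (∀ Q : ProjectForget.Vec d → Finset ι, ProjectForget.IsDeterministicOracle a b Q →
            ∀ t : ProjectForget.Trace d ι, ProjectForget.IsDeterministicRun f S a b Q t →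
              limsup (t.errorRatio (ProjectForget.hessian f xs) xs) atTop ≤ ENNReal.ofReal ρ) ∧
          (∀ Q : ProjectForget.Vec d → PMF (Finset ι), ProjectForget.IsRandomOracle Q →
            ∀ (Ω : Type v) [mΩ : MeasurableSpace Ω] (P : Measure Ω) [IsProbabilityMeasure P]
              (F : Filtration ℕ mΩ) (ans : ℕ → Ω → Finset ι) (t : Ω → ProjectForget.Trace d ι),
              ProjectForget.IsRandomRun P f S a b Q F ans t →
                ∀ᵐ ω ∂P, limsup ((t ω).errorRatio (ProjectForget.hessian f xs) xs) atTop
                  ≤ ENNReal.ofReal ρ)) := by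
  cases nonempty_fintype ι
  obtain ⟨xs, hxs⟩ := hf.exists_isOptimal hfeas hx₀
  refine ⟨xs, ⟨hxs, fun p hp => hf.isOptimal_unique hp hxs⟩,
    fun Q hQ t ht => ht.convergesTo_of_isDeterministicOracle hf ha hQ hxs,
    fun Q hQ Ω _ P _ F ans t ht => ht.ae_convergesTo hf hQ hxs, fun h2 hpos => ?_⟩
  -- `ρ` is fixed before any oracle or run is introduced.
  obtain ⟨ρ, hρ0, hρ1, hρ⟩ := ProjectForget.exists_limsup_errorRatio_le hf hxs h2 hpos
  refine ⟨ρ, hρ0, hρ1, fun Q hQ t ht =>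
    hρ _ t ht (ht.convergesTo_of_isDeterministicOracle hf ha hQ hxs),
    fun Q hQ Ω _ P _ F ans t ht => ?_⟩
  filter_upwards [ht.isRun, ht.ae_convergesTo hf hQ hxs] with ω hrun hconv
  exact hρ _ _ hrun hconv
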